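/- Let $d\in\mathbb N$ and let $(\Omega,\mathcal F,\mathbb P)$ be a probability space. \emph{Straight-line processes.} For probability measures $P_0,P_1$ on $\mathbb R^d$ let $\mathcal S(P_0,P_1)$ be the class of $\mathbb R^d$-valued stochastic processes $X=(X_t)_{t\in[0,1]}$ on $\Omega$ with almost surely continuous sample paths such that $(X_0,X_1)\sim P_0\otimes P_1$. Let $\mathcal S_{\mathrm{SL}}(P_0,P_1)$ be the class of all $X\in\mathcal S(P_0,P_1)$ such that (i) almost every sample path is absolutely continuous on $[0,1]$ (i.e. lies in $W^{1,1}([0,1];\mathbb R^d)$), and its velocity $\dot X_t$ satisfies $\mathbb E\int_0^1\|\dot X_t\|\,dt<\infty$; (ii) the conditional velocity $v(t,x)=\mathbb E[\dot X_t\mid X_t=x]$ has a version, i.e. there is a jointly measurable $v:[0,1]\times\mathbb R^d\to\mathbb R^d$ with $v(t,X_t)=\mathbb E[\dot X_t\mid X_t]$ almost surely for almost every $t\in[0,1]$, such that, for some $L>0$, $\|v(t,x)-v(t,y)\|\le L\|x-y\|$ for all $t\in[0,1]$ and $x,y\in\mathbb R^d$; (iii) this version $v$ has a flow map $\phi:[0,1]\times\mathbb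 R^d\to\mathbb R^d$, that is $\partial_t\phi(t,x)=v(t,\phi(t,x))$ and $\phi(0,x)=x$ for all $(t,x)$, and $\partial_t^2\phi(t,x)=0$ for all $(t,x)\in[0,1]\times\mathbb R^d$. \emph{Theorem.} Let $P$ be a probability measure on $\mathbb R^d$ with disconnected support on $S_0$ and $S_1$: the sets $S_0,S_1\subseteq\mathbb R^d$ are bounded and open, their closed convex hulls are disjoint, $\operatorname{supp}(P)=\overline{S_0}\cup\overline{S_1}$, and $P(S_0)>0$, $P(S_1)>0$. Suppose that $P(S_0)\neq P(S_1)$. Then $$\mathcal S_{\mathrm{SL}}(P,P)=\emptyset .$$ -/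

import Mathlib

open MeasureTheory

/-- The Euclidean space `ℝᵈ`. -/
abbrev Euc (d : ℕ) : Type := EuclideanSpace ℝ (Fin d)

/-- The measure `P` on `ℝᵈ` has disconnected support on the sets `S₀` and `S₁`. -/
structure HasDisconnectedSupportOn {d : ℕ} (P : Measure (Euc d)) (S₀ S₁ : Set (Euc d)) :
    Prop where
  isOpen₀ : IsOpen S₀
  isOpen₁ : IsOpen S₁
  isBounded₀ : Bornology.IsBounded S₀
  isBounded₁ : Bornology.IsBounded S₁
  disjoint_closedConvexHull : closedConvexHull ℝ S₀ ∩ closedConvexHull ℝ S₁ = ∅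
  support_eq : P.support = closure S₀ ∪ closure S₁
  pos₀ : 0 < P S₀
  pos₁ : 0 < P S₁

/-- A curve on `[0,1]` regarded as a function of a real variable (constant on either side of
`[0,1]`), so that Mathlib's derivatives apply to it. -/
noncomputable def extendCurve {E : Type*} (γ : unitInterval → E) : ℝ → E :=
  Set.IccExtend zero_le_one γ

section Processes

variable {Ω : Type*} [MeasurableSpace Ω] {d : ℕ}

/-- The class `𝒮(P₀, P₁)`: processes `(X_t)` with index set `[0,1]` and values in `ℝᵈ`, with
almost surely continuous sample paths, such that `(X₀, X₁)` has law `P₀ ⊗ P₁`. -/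
structure IsConnectingProcess (μ : Measure Ω) (P₀ P₁ : Measure (Euc d))
    (X : unitInterval → Ω → Euc d) : Prop where
  measurable : ∀ t, Measurable (X t)
  continuous_paths : ∀ᵐ ω ∂μ, Continuous fun t => X t ω
  law_endpoints : μ.map (fun ω => (X 0 ω, X 1 ω)) = P₀.prod P₁

/-- The velocity `Ẋ_t(ω)` of the sample path of `ω` at time `t`. For an absolutely continuous
path it is defined for almost every `t` and is the weak derivative of the path. -/
noncomputable def pathVelocity (X : unitInterval → Ω → Euc d) (t : unitInterval) (ω : Ω) :
    Euc d :=
  deriv (extendCurve fun s => X s ω) (t : ℝ)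

/-- `Ẋ` makes sense and is integrable, so that `E[Ẋ_t | X_t]` is well-defined: almost every sample
path is absolutely continuous on `[0,1]` (that is, it is a continuous path in the Sobolev space
`W^{1,1}([0,1]; ℝᵈ)`), and `E ∫₀¹ ‖Ẋ_t‖ dt < ∞`. -/
structure HasIntegrableVelocity (μ : Measure Ω) (X : unitInterval → Ω → Euc d) : Prop where
  absolutelyContinuous_paths :
    ∀ᵐ ω ∂μ, AbsolutelyContinuousOnInterval (extendCurve fun s => X s ω) 0 1
  integrable :
    Integrable (fun p : unitInterval × Ω => pathVelocity X p.1 p.2)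
      ((volume : Measure unitInterval).prod μ)

/-- The field `v` is jointly measurable and is a version of the conditional velocity
`v(t, x) = E[Ẋ_t | X_t = x]`. Since `Ẋ_t` is defined for almost every `t` only, so is the
conditional expectation. -/
structure IsConditionalVelocity (μ : Measure Ω) (X : unitInterval → Ω → Euc d)
    (v : unitInterval → Euc d → Euc d) : Prop where
  measurable : Measurable fun p : unitInterval × Euc d => v p.1 p.2
  ae_eq_condExp : ∀ᵐ t : unitInterval,
    (fun ω => v t (X t ω)) =ᵐ[μ]
      μ[pathVelocity X t | MeasurableSpace.comap (X t) inferInstance]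

/-- `‖v(t, x) - v(t, y)‖ ≤ L ‖x - y‖` for all `t`, `x`, `y` and some `L > 0`. -/
def IsUniformlyLipschitz (v : unitInterval → Euc d → Euc d) : Prop :=
  ∃ L : ℝ, 0 < L ∧ ∀ t x y, ‖v t x - v t y‖ ≤ L * ‖x - y‖

/-- `φ` is the flow map of `v`: `∂ₜ φ(t, x) = v(t, φ(t, x))` and `φ(0, x) = x`, for all
`t ∈ [0,1]` (with one-sided derivatives at the end points) and all `x`. -/
structure IsFlowMap (v φ : unitInterval → Euc d → Euc d) : Prop where
  initial : ∀ x, φ 0 x = x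
  hasDeriv : ∀ (t : unitInterval) (x : Euc d),
    HasDerivWithinAt (extendCurve fun s => φ s x) (v t (φ t x)) (Set.Icc 0 1) (t : ℝ)

/-- `∂ₜ² φ(t, x) = 0` for all `t ∈ [0,1]` and all `x`. -/
def HasNoAcceleration (φ : unitInterval → Euc d → Euc d) : Prop :=
  ∀ (t : unitInterval) (x : Euc d),
    HasDerivWithinAt (derivWithin (extendCurve fun s => φ s x) (Set.Icc 0 1)) 0
      (Set.Icc 0 1) (t : ℝ)

/-- The class `𝒮_SL(P₀, P₁)` of straight-line processes connecting `P₀` and `P₁`, over the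
probability space `(Ω, μ)`. -/
def straightLineProcesses (μ : Measure Ω) (P₀ P₁ : Measure (Euc d)) :
    Set (unitInterval → Ω → Euc d) :=
  {X | IsConnectingProcess μ P₀ P₁ X ∧ HasIntegrableVelocity μ X ∧
    ∃ v φ : unitInterval → Euc d → Euc d,
      IsConditionalVelocity μ X v ∧ IsUniformlyLipschitz v ∧ IsFlowMap v φ ∧
        HasNoAcceleration φ}

end Processes

/-! Without acceleration the flow is `φ t x = x + t • v 0 x`, and `v` is constant along each line,
so each `φ t` is injective. The crux is that `X t` almost surely stays in `φ t '' K`, where `K` is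
the compact support of `P`. Take a finite ε-net of `K` and let `z` be the displacement from `X t` to
the nearest flow line through the net. Along a path, ‖z‖ grows at rate ⟪z/‖z‖, Ẋ - v(t, X)⟫ plus at
most L‖z‖. The direction z/‖z‖ depends only on (t, X_t), so the first term has mean zero, and
Grönwall gives E‖z‖ ≤ exp(L t) ε (`exists_norm_sub_net_lintegral_le`). Let ε → 0. By continuity in
`t`, a path starting in one part of `K` cannot leave the moving image of that part. Independence of
`X 0` and `X 1` then makes the image at time 1 of each part `P`-null, yet `X 1` lies in their union.
-/

theorem IsFlowMap.eq_add_smul_and_velocity_eq {d : ℕ} {v φ : unitInterval → Euc d → Euc d}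
    (hφ : IsFlowMap v φ) (ha : HasNoAcceleration φ) (t : unitInterval) (x : Euc d) :
    φ t x = x + (t : ℝ) • v 0 x ∧ v t (φ t x) = v 0 x := by
  set γ : ℝ → Euc d := extendCurve fun s => φ s x with hγ
  have hγv : ∀ s : unitInterval, γ s = φ s x := fun s => by
    simp [hγ, extendCurve, Set.IccExtend_val]
  have hu : UniqueDiffOn ℝ (Set.Icc (0 : ℝ) 1) := uniqueDiffOn_Icc zero_lt_one
  have hd : ∀ s : unitInterval, derivWithin γ (Set.Icc 0 1) s = v s (φ s x) := fun s =>
    (hφ.hasDeriv s x).derivWithin (hu s s.2)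
  have hconst := constant_of_derivWithin_zero (f := derivWithin γ (Set.Icc 0 1)) (a := 0) (b := 1)
    (fun s hs => (ha ⟨s, hs⟩ x).differentiableWithinAt)
    (fun s hs => (ha ⟨s, hs.1, hs.2.le⟩ x).derivWithin (hu s ⟨hs.1, hs.2.le⟩))
  have hvel : ∀ s : unitInterval, v s (φ s x) = v 0 x := fun s => by
    have h0 := hd 0
    rw [hφ.initial] at h0
    rw [← hd s, ← h0]
    exact hconst s s.2
  refine ⟨?_, hvel t⟩
  have hder : ∀ s ∈ Set.Icc (0 : ℝ) 1,
      HasDerivWithinAt (fun r => γ r - r • v 0 x) 0 (Set.Icc 0 1) s := fun s hs => by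
    have h1 := hφ.hasDeriv ⟨s, hs⟩ x
    rw [hvel] at h1
    have h2 := h1.sub ((hasDerivWithinAt_id s (Set.Icc (0 : ℝ) 1)).smul_const (v 0 x))
    rw [one_smul, sub_self] at h2
    exact h2
  have h := constant_of_derivWithin_zero (fun s hs => (hder s hs).differentiableWithinAt)
    (fun s hs => (hder s ⟨hs.1, hs.2.le⟩).derivWithin (hu s ⟨hs.1, hs.2.le⟩)) t t.2
  have h00 : γ 0 = x := by simpa [hφ.initial] using hγv 0
  simp only [hγv, h00, zero_smul, sub_zero] at h
  exact sub_eq_iff_eq_add.1 h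

/-! ### Distance from one path to finitely many lines -/

/-- Measurability of the selected displacement makes its direction a measurable function of (t,
X_t), hence an admissible test function for the conditional velocity. -/
theorem exists_measurable_argmin_norm {α E : Type*} [MeasurableSpace α] [NormedAddCommGroup E]
    [MeasurableSpace E] [BorelSpace E] {c : ℕ → α → E}
    (hc : ∀ j, Measurable (c j)) (n : ℕ) :
    ∃ i : α → ℕ, (Measurable fun p => c (i p) p) ∧
      ∀ p, i p ≤ n ∧ ∀ j ≤ n, ‖c (i p) p‖ ≤ ‖c j p‖ := by
  induction n with
  | zero => exact ⟨fun _ => 0, hc 0, fun p => ⟨le_rfl, fun j hj => by simp_all⟩⟩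
  | succ n ih =>
    obtain ⟨i, hm, hi⟩ := ih
    classical
    have hset : MeasurableSet {p | ‖c (n + 1) p‖ ≤ ‖c (i p) p‖} :=
      measurableSet_le (hc _).norm hm.norm
    refine ⟨fun p => if ‖c (n + 1) p‖ ≤ ‖c (i p) p‖ then n + 1 else i p, ?_, fun p => ?_⟩
    · have heq : (fun p => c (if ‖c (n + 1) p‖ ≤ ‖c (i p) p‖ then n + 1 else i p) p) =
          fun p => if ‖c (n + 1) p‖ ≤ ‖c (i p) p‖ then c (n + 1) p else c (i p) p := by
        funext p
        split_ifs <;> rfl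
      exact heq ▸ Measurable.ite hset (hc (n + 1)) hm
    · obtain ⟨h1, h2⟩ := hi p
      beta_reduce
      split_ifs with h
      · refine ⟨le_rfl, fun j hj => ?_⟩
        rcases Nat.le_succ_iff.1 hj with hj | rfl
        · exact h.trans (h2 j hj)
        · exact le_rfl
      · refine ⟨h1.trans n.le_succ, fun j hj => ?_⟩
        rcases Nat.le_succ_iff.1 hj with hj | rfl
        · exact h2 j hj
        · exact (not_le.1 h).le

theorem AbsolutelyContinuousOnInterval.of_dist_le_add {X Y Z : Type*} [PseudoMetricSpace X]
    [PseudoMetricSpace Y] [PseudoMetricSpace Z] {f : ℝ → X} {g : ℝ → Y} {h : ℝ → Z} {a b : ℝ}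
    (hf : AbsolutelyContinuousOnInterval f a b) (hg : AbsolutelyContinuousOnInterval g a b)
    (hle : ∀ s t, dist (h s) (h t) ≤ dist (f s) (f t) + dist (g s) (g t)) :
    AbsolutelyContinuousOnInterval h a b := by
  refine squeeze_zero (fun E => Finset.sum_nonneg fun i _ => dist_nonneg) (fun E => ?_)
    (by simpa using Filter.Tendsto.add hf hg)
  rw [← Finset.sum_add_distrib]
  exact Finset.sum_le_sum fun i _ => hle _ _

theorem AbsolutelyContinuousOnInterval.exists_min {h : ℕ → ℝ → ℝ} {a b : ℝ}
    (hh : ∀ j, AbsolutelyContinuousOnInterval (h j) a b) (n : ℕ) :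
    ∃ f : ℝ → ℝ, AbsolutelyContinuousOnInterval f a b ∧ (∀ s, ∀ j ≤ n, f s ≤ h j s) ∧
      ∀ s, ∃ j ≤ n, f s = h j s := by
  induction n with
  | zero => exact ⟨h 0, hh 0, fun s j hj => by simp_all, fun s => ⟨0, le_rfl, rfl⟩⟩
  | succ n ih =>
    obtain ⟨f, hf, hle, hex⟩ := ih
    refine ⟨fun s => min (f s) (h (n + 1) s), hf.of_dist_le_add (hh (n + 1)) fun s t => ?_,
      fun s j hj => ?_, fun s => ?_⟩
    · refine (abs_min_sub_min_le_max _ _ _ _).trans (max_le ?_ ?_)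
      · exact le_add_of_nonneg_right dist_nonneg
      · exact le_add_of_nonneg_left dist_nonneg
    · rcases Nat.le_succ_iff.1 hj with hj | rfl
      · exact (min_le_left _ _).trans (hle s j hj)
      · exact min_le_right _ _
    · rcases min_choice (f s) (h (n + 1) s) with hm | hm
      · obtain ⟨j, hj, hj'⟩ := hex s
        exact ⟨j, hj.trans n.le_succ, hm.trans hj'⟩
      · exact ⟨n + 1, le_rfl, hm⟩

/-- `f` touches `‖c‖` from below at `s`, so the derivatives agree there. If `c s = 0`, then `f` has
a minimum and both sides vanish, as `0⁻¹ = 0`. -/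
theorem deriv_eq_inner_of_le_norm {E : Type*} [NormedAddCommGroup E] [InnerProductSpace ℝ E]
    {f : ℝ → ℝ} {c : ℝ → E} {c' : E} {s : ℝ} (hf : DifferentiableAt ℝ f s)
    (hc : HasDerivAt c c' s) (hnonneg : ∀ r, 0 ≤ f r) (hle : ∀ r, f r ≤ ‖c r‖)
    (heq : f s = ‖c s‖) : deriv f s = inner ℝ (‖c s‖⁻¹ • c s) c' := by
  by_cases h0 : c s = 0
  · have hmin : IsLocalMin f s := Filter.Eventually.of_forall fun r => by
      rw [heq, h0, norm_zero]; exact hnonneg r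
    simp [hmin.deriv_eq_zero, h0]
  · have hn : HasDerivAt (fun r => ‖c r‖) (inner ℝ (‖c s‖⁻¹ • c s) c') s := by
      have h1 := hc.norm_sq.sqrt (by positivity)
      simp only [Real.sqrt_sq (norm_nonneg _)] at h1
      convert h1 using 1
      rw [real_inner_smul_left]
      field_simp
    have hmax : IsLocalMax (fun r => f r - ‖c r‖) s := Filter.Eventually.of_forall fun r => by
      simp only [heq, sub_self, sub_nonpos]; exact hle r
    have := hmax.hasDerivAt_eq_zero (hf.hasDerivAt.sub hn)
    linarith

theorem AbsolutelyContinuousOnInterval.ae_differentiableAt_of_finiteDimensional {E : Type*}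
    [NormedAddCommGroup E] [NormedSpace ℝ E] [FiniteDimensional ℝ E] {f : ℝ → E} {a b : ℝ}
    (hf : AbsolutelyContinuousOnInterval f a b) :
    ∀ᵐ s, s ∈ Set.uIcc a b → DifferentiableAt ℝ f s := by
  have h1 : ∀ᵐ s : ℝ, s ≠ min a b := by simp [ae_iff, measure_singleton]
  have h2 : ∀ᵐ s : ℝ, s ≠ max a b := by simp [ae_iff, measure_singleton]
  filter_upwards [hf.boundedVariationOn.locallyBoundedVariationOn.ae_differentiableWithinAt_of_mem,
    h1, h2] with s hs h1 h2 hmem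
  exact (hs hmem).differentiableAt
    (Icc_mem_nhds (lt_of_le_of_ne hmem.1 h1.symm) (lt_of_le_of_ne hmem.2 h2))

/-- Pathwise Grönwall: the selection `i` may jump, but ‖z‖ agrees on [0,1] with a finite minimum of
absolutely continuous functions, so the fundamental theorem of calculus applies. -/
theorem exp_mul_norm_sub_le_add_intervalIntegral {E : Type*} [NormedAddCommGroup E]
    [InnerProductSpace ℝ E] [FiniteDimensional ℝ E] {x V : ℝ → E}
    (hx : AbsolutelyContinuousOnInterval x 0 1) {y w : ℕ → E} {n : ℕ} {i : ℝ → ℕ} {z : ℝ → E}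
    {L T : ℝ} (hT : T ∈ Set.Icc (0 : ℝ) 1) (hz : ∀ s, z s = x s - (y (i s) + s • w (i s)))
    (hi : ∀ s ∈ Set.Icc (0 : ℝ) 1, i s ≤ n ∧ ∀ j ≤ n, ‖z s‖ ≤ ‖x s - (y j + s • w j)‖)
    (hV : ∀ s ∈ Set.Icc (0 : ℝ) 1, ‖V s - w (i s)‖ ≤ L * ‖z s‖)
    (hint : IntervalIntegrable
      (fun s => Real.exp (-L * s) * inner ℝ (‖z s‖⁻¹ • z s) (deriv x s - V s)) volume 0 T) :
    Real.exp (-L * T) * ‖z T‖ ≤ ‖z 0‖ +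
      ∫ s in (0 : ℝ)..T, Real.exp (-L * s) * inner ℝ (‖z s‖⁻¹ • z s) (deriv x s - V s) := by
  have hcurve : ∀ j s, HasDerivAt (fun r : ℝ => y j + r • w j) (w j) s := fun j s => by
    simpa using ((hasDerivAt_id s).smul_const (w j)).const_add (y j)
  have hac : ∀ j, AbsolutelyContinuousOnInterval (fun r => ‖x r - (y j + r • w j)‖) 0 1 :=
    fun j => by
      have hc : AbsolutelyContinuousOnInterval (fun r : ℝ => y j + r • w j) 0 1 :=
        ContDiffOn.absolutelyContinuousOnInterval (ContDiff.contDiffOn (by fun_prop))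
      exact hx.of_dist_le_add hc fun s t =>
        (dist_norm_norm_le _ _).trans (by rw [← dist_eq_norm]; exact dist_sub_sub_le _ _ _ _)
  obtain ⟨f, hf, hfle, hfex⟩ := AbsolutelyContinuousOnInterval.exists_min hac n
  have hfz : ∀ s ∈ Set.Icc (0 : ℝ) 1, f s = ‖z s‖ := fun s hs => by
    obtain ⟨j, hj, hj'⟩ := hfex s
    refine le_antisymm ?_ (hj' ▸ (hi s hs).2 j hj)
    rw [hz]; exact hfle s _ (hi s hs).1
  have hf0 : ∀ s, 0 ≤ f s := fun s => by
    obtain ⟨j, -, hj'⟩ := hfex s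
    rw [hj']; exact norm_nonneg _
  have hsub : Set.uIcc 0 T ⊆ Set.uIcc (0 : ℝ) 1 := by
    rw [Set.uIcc_of_le hT.1, Set.uIcc_of_le zero_le_one]; exact Set.Icc_subset_Icc_right hT.2
  have hfT := hf.mono hsub
  have hed : ∀ s, HasDerivAt (fun r : ℝ => Real.exp (-L * r)) (Real.exp (-L * s) * (-L)) s :=
    fun s => by simpa using ((hasDerivAt_id s).const_mul (-L)).exp
  have he : AbsolutelyContinuousOnInterval (fun r : ℝ => Real.exp (-L * r)) 0 T :=
    ContDiffOn.absolutelyContinuousOnInterval (ContDiff.contDiffOn (by fun_prop))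
  -- The derivative of the weight `exp (-L s)` cancels the growth term L‖z‖.
  have hftc := hfT.integral_deriv_mul_eq_sub he
  have hle : (∫ s in (0 : ℝ)..T, deriv f s * Real.exp (-L * s) +
      f s * deriv (fun r : ℝ => Real.exp (-L * r)) s) ≤
      ∫ s in (0 : ℝ)..T, Real.exp (-L * s) * inner ℝ (‖z s‖⁻¹ • z s) (deriv x s - V s) := by
    refine intervalIntegral.integral_mono_ae_restrict hT.1
      ((hfT.intervalIntegrable_deriv.mul_continuousOn he.continuousOn).add
        (he.intervalIntegrable_deriv.continuousOn_mul hfT.continuousOn)) hint ?_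
    rw [Filter.EventuallyLE, ae_restrict_iff' measurableSet_Icc]
    filter_upwards [hf.ae_differentiableAt_of_finiteDimensional,
      hx.ae_differentiableAt_of_finiteDimensional] with s hfs hxs hs
    have hs1 : s ∈ Set.Icc (0 : ℝ) 1 := ⟨hs.1, hs.2.trans hT.2⟩
    rw [Set.uIcc_of_le zero_le_one] at hfs hxs
    have hd : deriv f s = inner ℝ (‖z s‖⁻¹ • z s) (deriv x s - w (i s)) := by
      rw [deriv_eq_inner_of_le_norm (hfs hs1) ((hxs hs1).hasDerivAt.sub (hcurve (i s) s)) hf0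
        (fun r => hfle r _ (hi s hs1).1) (by rw [hfz s hs1, hz]; rfl)]
      simp only [hz, Pi.sub_apply]
    have hN : ‖‖z s‖⁻¹ • z s‖ ≤ 1 := by
      rw [norm_smul, norm_inv, norm_norm]; exact inv_mul_le_one
    have hin : inner ℝ (‖z s‖⁻¹ • z s) (V s - w (i s)) ≤ L * ‖z s‖ :=
      (real_inner_le_norm _ _).trans
        ((mul_le_of_le_one_left (norm_nonneg _) hN).trans (hV s hs1))
    have hsplit : inner ℝ (‖z s‖⁻¹ • z s) (deriv x s - w (i s)) =
        inner ℝ (‖z s‖⁻¹ • z s) (deriv x s - V s) + inner ℝ (‖z s‖⁻¹ • z s) (V s - w (i s)) := by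
      rw [← inner_add_right]; congr 1; abel
    rw [hd, hfz s hs1, (hed s).deriv, hsplit]
    nlinarith [mul_le_mul_of_nonneg_left hin (Real.exp_pos (-L * s)).le]
  rw [hftc, hfz T hT, hfz 0 ⟨le_rfl, zero_le_one⟩] at hle
  simp only [mul_zero, Real.exp_zero, mul_one] at hle
  linarith

/-! ### Averaging over the paths -/

theorem intervalIntegrable_comp_projIcc {g : unitInterval → ℝ} (hg : Integrable g)
    (T : unitInterval) :
    IntervalIntegrable (fun s => g (Set.projIcc 0 1 zero_le_one s)) volume 0 T := by
  have h : IntegrableOn (fun s => g (Set.projIcc 0 1 zero_le_one s)) (Set.Icc 0 1) := by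
    rw [IntegrableOn, ← unitInterval.measurePreserving_coe.integrable_comp_emb
      unitInterval.measurableEmbedding_coe]
    simpa [Function.comp_def] using hg
  refine IntegrableOn.intervalIntegrable (h.mono_set ?_)
  rw [Set.uIcc_of_le T.2.1]
  exact Set.Icc_subset_Icc_right T.2.2

theorem intervalIntegral_comp_projIcc (g : unitInterval → ℝ) (T : unitInterval) :
    ∫ s in (0 : ℝ)..T, g (Set.projIcc 0 1 zero_le_one s) = ∫ s in Set.Iic T, g s := by
  have h := unitInterval.measurePreserving_coe.setIntegral_preimage_emb
    unitInterval.measurableEmbedding_coe (fun s => g (Set.projIcc 0 1 zero_le_one s))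
    (Set.Iic (T : ℝ))
  rw [Measure.restrict_restrict measurableSet_Iic] at h
  have h1 : Set.Iic (T : ℝ) ∩ unitInterval = Set.Icc 0 (T : ℝ) := by
    ext s
    exact ⟨fun hs => ⟨hs.2.1, hs.1⟩, fun hs => ⟨hs.2, hs.1, hs.2.trans T.2.2⟩⟩
  have h2 : ((↑) : unitInterval → ℝ) ⁻¹' Set.Iic (T : ℝ) = Set.Iic T := rfl
  rw [h1, h2] at h
  rw [intervalIntegral.integral_of_le T.2.1, ← integral_Icc_eq_integral_Ioc, ← h]
  simp

theorem aemeasurable_uncurry_of_ae_continuous {Ω E : Type*} [MeasurableSpace Ω] {μ : Measure Ω}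
    [SFinite μ] [TopologicalSpace E] [TopologicalSpace.PseudoMetrizableSpace E]
    [MeasurableSpace E] [BorelSpace E] [Nonempty E] {X : unitInterval → Ω → E}
    (hm : ∀ t, Measurable (X t)) (hc : ∀ᵐ ω ∂μ, Continuous fun t => X t ω) :
    AEMeasurable (fun p : unitInterval × Ω => X p.1 p.2)
      ((volume : Measure unitInterval).prod μ) := by
  classical
  obtain ⟨A, hA, hAm, hAμ⟩ := exists_measurable_superset_of_null (ae_iff.1 hc)
  let e : E := Classical.arbitrary E
  refine ⟨fun p => if p.2 ∈ A then e else X p.1 p.2, ?_, ?_⟩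
  · refine measurable_uncurry_of_continuous_of_measurable
      (u := fun t ω => if ω ∈ A then e else X t ω) (fun ω => ?_) fun t =>
        Measurable.ite hAm measurable_const (hm t)
    by_cases hω : ω ∈ A
    · simpa [hω] using continuous_const
    · simpa [hω] using not_not.1 fun h => hω (hA h)
  · have : ∀ᵐ p : unitInterval × Ω ∂(volume : Measure unitInterval).prod μ, p.2 ∉ A :=
      Measure.quasiMeasurePreserving_snd.ae (measure_eq_zero_iff_ae_notMem.1 hAμ)
    filter_upwards [this] with p hp
    simp [hp]

section

variable {Ω : Type*} [MeasurableSpace Ω] {μ : Measure Ω} [IsProbabilityMeasure μ] {d : ℕ}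
  {X : unitInterval → Ω → Euc d} {v : unitInterval → Euc d → Euc d}

theorem IsConditionalVelocity.integrable (hv : IsConditionalVelocity μ X v)
    (hX : AEMeasurable (fun p : unitInterval × Ω => X p.1 p.2)
      ((volume : Measure unitInterval).prod μ))
    (hvel : HasIntegrableVelocity μ X) :
    Integrable (fun p : unitInterval × Ω => v p.1 (X p.1 p.2))
      ((volume : Measure unitInterval).prod μ) := by
  have hmeas : AEStronglyMeasurable (fun p : unitInterval × Ω => v p.1 (X p.1 p.2))
      ((volume : Measure unitInterval).prod μ) :=
    (hv.measurable.comp_aemeasurable (measurable_fst.aemeasurable.prodMk hX)).aestronglyMeasurable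
  rw [integrable_prod_iff hmeas]
  refine ⟨?_, hvel.integrable.integral_norm_prod_left.mono'
    hmeas.norm.integral_prod_right' ?_⟩
  · filter_upwards [hv.ae_eq_condExp] with t ht
    exact integrable_condExp.congr ht.symm
  · filter_upwards [hv.ae_eq_condExp, hvel.integrable.prod_right_ae] with t ht hint
    rw [Real.norm_of_nonneg (integral_nonneg fun ω => norm_nonneg _)]
    calc ∫ ω, ‖v t (X t ω)‖ ∂μ
        = ∫ ω, ‖(μ[pathVelocity X t | MeasurableSpace.comap (X t) inferInstance]) ω‖ ∂μ :=
          integral_congr_ae (ht.mono fun ω h => by simp only [h])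
      _ ≤ ∫ ω, ‖pathVelocity X t ω‖ ∂μ := integral_norm_condExp_le _

/-- A bounded function of X_t pulls out of the conditional expectation given X_t. -/
theorem IsConditionalVelocity.ae_integral_inner_sub_eq_zero (hv : IsConditionalVelocity μ X v)
    (hm : ∀ t, Measurable (X t)) (hvel : HasIntegrableVelocity μ X)
    {N : unitInterval × Euc d → Euc d} (hN : Measurable N) {C : ℝ} (hN1 : ∀ p, ‖N p‖ ≤ C) :
    ∀ᵐ t : unitInterval,
      ∫ ω, inner ℝ (N (t, X t ω)) (pathVelocity X t ω - v t (X t ω)) ∂μ = 0 := by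
  filter_upwards [hv.ae_eq_condExp, hvel.integrable.prod_right_ae] with t ht hint
  have hle : MeasurableSpace.comap (X t) inferInstance ≤ ‹MeasurableSpace Ω› := (hm t).comap_le
  have hNt : Measurable[MeasurableSpace.comap (X t) inferInstance] fun ω => N (t, X t ω) :=
    (hN.comp measurable_prodMk_left).comp (comap_measurable (X t))
  have hpull := condExp_aestronglyMeasurable_bilin_of_bound (μ := μ) (innerSL ℝ) hle
    hNt.stronglyMeasurable.aestronglyMeasurable hint C
    (Filter.Eventually.of_forall fun ω => hN1 _)
  have hNm : AEStronglyMeasurable (fun ω => N (t, X t ω)) μ :=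
    (hN.comp (measurable_prodMk_left.comp (hm t))).aestronglyMeasurable
  have hi : ∀ g : Ω → Euc d, Integrable g μ →
      Integrable (fun ω => inner ℝ (N (t, X t ω)) (g ω)) μ := fun g hg =>
    (hg.norm.const_mul C).mono' (hNm.inner hg.aestronglyMeasurable)
      (Filter.Eventually.of_forall fun ω => (norm_inner_le_norm _ _).trans
        (mul_le_mul_of_nonneg_right (hN1 _) (norm_nonneg _)))
  have hvt : Integrable (fun ω => v t (X t ω)) μ := integrable_condExp.congr ht.symm
  simp only [inner_sub_right]
  rw [integral_sub (hi _ hint) (hi _ hvt), sub_eq_zero, ← integral_condExp hle]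
  refine integral_congr_ae ?_
  filter_upwards [hpull, ht] with ω h1 h2
  rw [h2]
  exact h1

theorem exists_norm_sub_net_lintegral_le (hm : ∀ t, Measurable (X t))
    (hc : ∀ᵐ ω ∂μ, Continuous fun t => X t ω) (hvel : HasIntegrableVelocity μ X)
    (hv : IsConditionalVelocity μ X v) {L : ℝ} (hL : ∀ t x y, ‖v t x - v t y‖ ≤ L * ‖x - y‖)
    {y w : ℕ → Euc d} (hw : ∀ (t : unitInterval) j, v t (y j + (t : ℝ) • w j) = w j) {n : ℕ}
    {ε : ℝ} (hε : ∀ᵐ ω ∂μ, ∃ j ≤ n, ‖X 0 ω - y j‖ ≤ ε) (T : unitInterval) :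
    ∃ i : Ω → ℕ, (∀ ω, i ω ≤ n) ∧
      ∫⁻ ω, ENNReal.ofReal ‖X T ω - (y (i ω) + (T : ℝ) • w (i ω))‖ ∂μ ≤
        ENNReal.ofReal (Real.exp (L * T) * ε) := by
  obtain ⟨i, him, hi⟩ := exists_measurable_argmin_norm
    (c := fun j (p : unitInterval × Euc d) => p.2 - (y j + (p.1 : ℝ) • w j))
    (fun j => by fun_prop) n
  set z : unitInterval × Euc d → Euc d := fun p => p.2 - (y (i p) + (p.1 : ℝ) • w (i p)) with hz
  have hzm : Measurable z := him
  set N : unitInterval × Euc d → Euc d := fun p => ‖z p‖⁻¹ • z p with hN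
  have hNm : Measurable N := hzm.norm.inv.smul hzm
  have hN1 : ∀ p, ‖N p‖ ≤ 1 := fun p => by
    rw [hN, norm_smul, norm_inv, norm_norm]; exact inv_mul_le_one
  have hX := aemeasurable_uncurry_of_ae_continuous (μ := μ) hm hc
  set H : unitInterval × Ω → ℝ := fun p =>
    inner ℝ (N (p.1, X p.1 p.2)) (pathVelocity X p.1 p.2 - v p.1 (X p.1 p.2)) with hH
  have hdiff := hvel.integrable.sub (hv.integrable hX hvel)
  have hHint : Integrable H ((volume : Measure unitInterval).prod μ) := by
    refine hdiff.norm.mono' (AEStronglyMeasurable.inner (hNm.comp_aemeasurable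
      (measurable_fst.aemeasurable.prodMk hX)).aestronglyMeasurable hdiff.aestronglyMeasurable)
      (Filter.Eventually.of_forall fun p => (norm_inner_le_norm _ _).trans
        (mul_le_of_le_one_left (norm_nonneg _) (hN1 _)))
  set G : unitInterval × Ω → ℝ := fun p => Real.exp (-L * p.1) * H p with hG
  have hGint : Integrable G ((volume : Measure unitInterval).prod μ) := by
    obtain ⟨C, hC⟩ := isCompact_univ.exists_bound_of_continuousOn
      (f := fun t : unitInterval => Real.exp (-L * t)) (by fun_prop)
    exact hHint.bdd_mul (Measurable.aestronglyMeasurable (by fun_prop))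
      (Filter.Eventually.of_forall fun p => hC p.1 trivial)
  have hGT : Integrable G (((volume : Measure unitInterval).restrict (Set.Iic T)).prod μ) := by
    have := hGint.restrict (s := Set.Iic T ×ˢ Set.univ)
    rwa [← Measure.prod_restrict, Measure.restrict_univ] at this
  set J : Ω → ℝ := fun ω => ∫ s in Set.Iic T, G (s, ω) with hJ
  have hJint : Integrable J μ := hGT.integral_prod_right
  -- Fubini: at almost every time the inner expectation vanishes.
  have hJ0 : ∫ ω, J ω ∂μ = 0 := by
    rw [hJ, ← integral_prod_symm _ hGT, integral_prod _ hGT]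
    refine integral_eq_zero_of_ae (ae_restrict_of_ae ?_)
    filter_upwards [hv.ae_integral_inner_sub_eq_zero hm hvel hNm hN1] with s hs
    simp only [hG, hH, integral_const_mul, hs, mul_zero, Pi.zero_apply]
  have hpath : ∀ᵐ ω ∂μ, Real.exp (-L * T) * ‖z (T, X T ω)‖ ≤ ε + J ω := by
    filter_upwards [hvel.absolutelyContinuous_paths, hε, hGint.prod_left_ae] with ω hac hεω hGω
    set x : ℝ → Euc d := extendCurve fun s => X s ω with hx
    let pr : ℝ → unitInterval := Set.projIcc 0 1 zero_le_one
    have hxpr : ∀ s, x s = X (pr s) ω := fun s => rfl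
    have hpr : ∀ s ∈ Set.Icc (0 : ℝ) 1, (pr s : ℝ) = s := fun s hs => by
      simp [pr, Set.projIcc_of_mem _ hs]
    let z' : ℝ → Euc d := fun s => x s - (y (i (pr s, x s)) + s • w (i (pr s, x s)))
    have hz' : ∀ s ∈ Set.Icc (0 : ℝ) 1, z' s = z (pr s, x s) := fun s hs => by
      simp only [z', hz, hpr s hs]
    have hT0 : Set.uIcc 0 (T : ℝ) ⊆ Set.Icc 0 1 := by
      rw [Set.uIcc_of_le T.2.1]; exact Set.Icc_subset_Icc_right T.2.2
    have hcongr : ∀ s ∈ Set.uIcc 0 (T : ℝ), G (pr s, ω) =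
        Real.exp (-L * s) * inner ℝ (‖z' s‖⁻¹ • z' s) (deriv x s - v (pr s) (x s)) :=
      fun s hs => by
        simp only [hG, hH, hN, pathVelocity, hz' s (hT0 hs), hpr s (hT0 hs), ← hx, ← hxpr]
    have hkey := exp_mul_norm_sub_le_add_intervalIntegral (L := L) (y := y) (w := w) (n := n)
      (i := fun s => i (pr s, x s)) (z := z') (V := fun s => v (pr s) (x s)) hac T.2
      (fun s => rfl)
      (fun s hs => by
        have := hi (pr s, x s)
        simp only [hpr s hs] at this
        exact this)
      (fun s hs => by
        have h1 := hw (pr s) (i (pr s, x s))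
        rw [hpr s hs] at h1
        nth_rewrite 1 [← h1]
        exact hL _ _ _)
      ((intervalIntegrable_comp_projIcc hGω T).congr fun s hs =>
        hcongr s (Set.uIoc_subset_uIcc hs))
    rw [← intervalIntegral.integral_congr hcongr,
      intervalIntegral_comp_projIcc (fun s => G (s, ω)) T, hz' _ T.2,
      hz' 0 ⟨le_rfl, zero_le_one⟩] at hkey
    have hprT : ∀ t : unitInterval, pr t = t := fun t => Set.projIcc_val _ t
    have hpr0 : pr 0 = 0 := hprT 0
    simp only [hxpr, hprT, hpr0] at hkey
    obtain ⟨j, hj, hjε⟩ := hεω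
    have h0 := (hi (0, X 0 ω)).2 j hj
    simp only [Set.Icc.coe_zero, zero_smul, add_zero] at h0
    refine hkey.trans (add_le_add_left ?_ _)
    simp only [hz, Set.Icc.coe_zero, zero_smul, add_zero]
    exact h0.trans hjε
  refine ⟨fun ω => i (T, X T ω), fun ω => (hi _).1, ?_⟩
  have hle : ∀ᵐ ω ∂μ, ‖z (T, X T ω)‖ ≤ Real.exp (L * T) * (ε + J ω) := by
    filter_upwards [hpath] with ω h
    have := mul_le_mul_of_nonneg_left h (Real.exp_pos (L * T)).le
    rwa [← mul_assoc, ← Real.exp_add, neg_mul, add_neg_cancel, Real.exp_zero, one_mul] at this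
  have hint : Integrable (fun ω => Real.exp (L * T) * (ε + J ω)) μ :=
    ((integrable_const ε).add hJint).const_mul _
  calc ∫⁻ ω, ENNReal.ofReal ‖z (T, X T ω)‖ ∂μ
      ≤ ∫⁻ ω, ENNReal.ofReal (Real.exp (L * T) * (ε + J ω)) ∂μ :=
        lintegral_mono_ae (hle.mono fun ω h => ENNReal.ofReal_le_ofReal h)
    _ = ENNReal.ofReal (∫ ω, Real.exp (L * T) * (ε + J ω) ∂μ) :=
        (ofReal_integral_eq_lintegral_ofReal hint
          (hle.mono fun ω h => (norm_nonneg _).trans h)).symm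
    _ = ENNReal.ofReal (Real.exp (L * T) * ε) := by
        rw [integral_const_mul, integral_add (integrable_const ε) hJint, hJ0]
        simp

end

/-! ### Nets and moving compact sets -/

theorem IsCompact.exists_seq_net {E : Type*} [PseudoMetricSpace E] {K : Set E}
    (hK : IsCompact K) (hne : K.Nonempty) {ε : ℝ} (hε : 0 < ε) :
    ∃ (y : ℕ → E) (n : ℕ), (∀ j, y j ∈ K) ∧ ∀ x ∈ K, ∃ j ≤ n, dist x (y j) ≤ ε := by
  obtain ⟨y₀, hy₀⟩ := hne
  obtain ⟨s, hsK, hsf, hs⟩ := hK.finite_cover_balls hε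
  set l := hsf.toFinset.toList with hl
  have hmem : ∀ x, x ∈ l ↔ x ∈ s := fun x => by simp [hl]
  -- The default `y₀` lies in `K`, so indices past the end of the list are harmless.
  refine ⟨fun j => l.getD j y₀, l.length, fun j => ?_, fun x hx => ?_⟩
  · beta_reduce
    by_cases hj : j < l.length
    · rw [List.getD_eq_getElem _ _ hj]
      exact hsK ((hmem _).1 (List.getElem_mem hj))
    · rwa [List.getD_eq_default _ _ (not_lt.1 hj)]
  · obtain ⟨c, hc, hxc⟩ := Set.mem_iUnion₂.1 (hs hx)
    obtain ⟨j, hj, rfl⟩ := List.mem_iff_getElem.1 ((hmem c).2 hc)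
    refine ⟨j, hj.le, ?_⟩
    beta_reduce
    rw [List.getD_eq_getElem _ _ hj]
    exact (Metric.mem_ball.1 hxc).le

theorem isClosed_setOf_mem_image {I E : Type*} [TopologicalSpace I] [CompactSpace I] [T2Space I]
    [TopologicalSpace E] [T2Space E] {Φ : I → E → E} (hΦ : Continuous (Function.uncurry Φ))
    {K : Set E} (hK : IsCompact K) {γ : I → E} (hγ : Continuous γ) :
    IsClosed {t | γ t ∈ Φ t '' K} := by
  have hc : IsCompact ((fun p : I × E => (p.1, Φ p.1 p.2)) '' (Set.univ ×ˢ K)) :=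
    (isCompact_univ.prod hK).image (continuous_fst.prodMk hΦ)
  convert hc.isClosed.preimage (continuous_id.prodMk hγ) using 1
  ext t
  constructor
  · rintro ⟨x, hx, hxt⟩
    exact ⟨(t, x), ⟨trivial, hx⟩, by simp [hxt]⟩
  · rintro ⟨⟨s, x⟩, ⟨-, hx⟩, hst⟩
    simp only [id, Prod.mk.injEq] at hst
    obtain ⟨rfl, h⟩ := hst
    exact ⟨x, hx, h⟩

/-- The times spent in the two disjoint images form complementary closed sets, so each is clopen in
a connected space. -/
theorem mem_image_of_forall_mem_image_union {I E : Type*} [TopologicalSpace I] [CompactSpace I]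
    [T2Space I] [PreconnectedSpace I] [TopologicalSpace E] [T2Space E] {Φ : I → E → E}
    (hΦ : Continuous (Function.uncurry Φ)) (hinj : ∀ t, Function.Injective (Φ t)) {K₀ K₁ : Set E}
    (hK₀ : IsCompact K₀) (hK₁ : IsCompact K₁) (hdisj : Disjoint K₀ K₁) {γ : I → E}
    (hγ : Continuous γ) (hmem : ∀ t, γ t ∈ Φ t '' (K₀ ∪ K₁)) {a : I} (ha : γ a ∈ Φ a '' K₀)
    (t : I) : γ t ∈ Φ t '' K₀ := by
  have h₀ := isClosed_setOf_mem_image hΦ hK₀ hγ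
  have h₁ := isClosed_setOf_mem_image hΦ hK₁ hγ
  have hcompl : {t | γ t ∈ Φ t '' K₀} = {t | γ t ∈ Φ t '' K₁}ᶜ := by
    ext s
    constructor
    · intro h h'
      exact Set.disjoint_left.1 (Set.disjoint_image_of_injective (hinj s) hdisj) h h'
    · intro h
      have := hmem s
      rw [Set.image_union] at this
      exact this.resolve_right h
  have hclopen : IsClopen {t | γ t ∈ Φ t '' K₀} := ⟨h₀, hcompl ▸ h₁.isOpen_compl⟩
  exact Set.eq_univ_iff_forall.1 (hclopen.eq_univ ⟨a, ha⟩) t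

/-! ### Confinement to the flow image of the support -/

section

variable {Ω : Type*} [MeasurableSpace Ω] {μ : Measure Ω} [IsProbabilityMeasure μ] {d : ℕ}
  {X : unitInterval → Ω → Euc d} {v φ : unitInterval → Euc d → Euc d}

theorem IsFlowMap.continuous_uncurry (hφ : IsFlowMap v φ) (ha : HasNoAcceleration φ)
    (hL : IsUniformlyLipschitz v) : Continuous (Function.uncurry φ) := by
  obtain ⟨L, hL0, hL⟩ := hL
  have hv : Continuous (v 0) := (LipschitzWith.of_dist_le_mul (K := ⟨L, hL0.le⟩) fun x y => by
    rw [dist_eq_norm, dist_eq_norm]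
    exact hL 0 x y).continuous
  have : Function.uncurry φ = fun p => p.2 + (p.1 : ℝ) • v 0 p.2 :=
    funext fun p => (hφ.eq_add_smul_and_velocity_eq ha p.1 p.2).1
  rw [this]
  fun_prop

/-- The velocity at the current position equals the initial one, so the line can be traced back. -/
theorem IsFlowMap.injective (hφ : IsFlowMap v φ) (ha : HasNoAcceleration φ) (t : unitInterval) :
    Function.Injective (φ t) := fun x y hxy => by
  obtain ⟨hx, hvx⟩ := hφ.eq_add_smul_and_velocity_eq ha t x
  obtain ⟨hy, hvy⟩ := hφ.eq_add_smul_and_velocity_eq ha t y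
  have hv : v 0 x = v 0 y := by rw [← hvx, ← hvy, hxy]
  rw [hx, hy, hv] at hxy
  exact add_right_cancel hxy

theorem IsFlowMap.ae_mem_image (hφ : IsFlowMap v φ) (ha : HasNoAcceleration φ)
    (hm : ∀ t, Measurable (X t)) (hc : ∀ᵐ ω ∂μ, Continuous fun t => X t ω)
    (hvel : HasIntegrableVelocity μ X) (hv : IsConditionalVelocity μ X v)
    (hL : IsUniformlyLipschitz v) {K : Set (Euc d)} (hK : IsCompact K)
    (hX₀ : ∀ᵐ ω ∂μ, X 0 ω ∈ K) (T : unitInterval) : ∀ᵐ ω ∂μ, X T ω ∈ φ T '' K := by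
  have hφc := hφ.continuous_uncurry ha hL
  obtain ⟨L, hL0, hL⟩ := hL
  obtain ⟨ω₀, hω₀⟩ := hX₀.exists
  have hKne : K.Nonempty := ⟨_, hω₀⟩
  have hcompact : IsCompact (φ T '' K) := hK.image (hφc.comp (Continuous.prodMk_right T))
  have hbound : ∀ ε > 0, ∫⁻ ω, ENNReal.ofReal (Metric.infDist (X T ω) (φ T '' K)) ∂μ ≤
      ENNReal.ofReal (Real.exp (L * T) * ε) := fun ε hε => by
    obtain ⟨y, n, hyK, hy⟩ := hK.exists_seq_net hKne hε
    obtain ⟨i, -, hi⟩ := exists_norm_sub_net_lintegral_le (y := y) (w := fun j => v 0 (y j))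
      hm hc hvel hv hL
      (fun t j => by
        obtain ⟨h1, h2⟩ := hφ.eq_add_smul_and_velocity_eq ha t (y j)
        rw [← h1, h2])
      (hX₀.mono fun ω hω => by simpa only [dist_eq_norm] using hy _ hω) T
    refine (lintegral_mono fun ω => ENNReal.ofReal_le_ofReal ?_).trans hi
    rw [← (hφ.eq_add_smul_and_velocity_eq ha T (y (i ω))).1, ← dist_eq_norm]
    exact Metric.infDist_le_dist_of_mem (Set.mem_image_of_mem _ (hyK _))
  have hzero : ∫⁻ ω, ENNReal.ofReal (Metric.infDist (X T ω) (φ T '' K)) ∂μ = 0 := by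
    refine le_antisymm (ENNReal.le_of_forall_pos_le_add fun ε hε _ => ?_) zero_le
    -- The mesh is chosen to cancel the Grönwall factor.
    refine (hbound (Real.exp (-(L * T)) * ε) (by positivity)).trans ?_
    rw [← mul_assoc, ← Real.exp_add, add_neg_cancel, Real.exp_zero, one_mul, zero_add,
      ENNReal.ofReal_coe_nnreal]
  rw [lintegral_eq_zero_iff (Measurable.ennreal_ofReal (by fun_prop))] at hzero
  filter_upwards [hzero] with ω hω
  rw [hcompact.isClosed.mem_iff_infDist_zero (hKne.image _)]
  exact le_antisymm (ENNReal.ofReal_eq_zero.1 hω) Metric.infDist_nonneg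

theorem IsFlowMap.ae_forall_mem_image (hφ : IsFlowMap v φ) (ha : HasNoAcceleration φ)
    (hm : ∀ t, Measurable (X t)) (hc : ∀ᵐ ω ∂μ, Continuous fun t => X t ω)
    (hvel : HasIntegrableVelocity μ X) (hv : IsConditionalVelocity μ X v)
    (hL : IsUniformlyLipschitz v) {K : Set (Euc d)} (hK : IsCompact K)
    (hX₀ : ∀ᵐ ω ∂μ, X 0 ω ∈ K) : ∀ᵐ ω ∂μ, ∀ t, X t ω ∈ φ t '' K := by
  obtain ⟨D, hDc, hD⟩ := TopologicalSpace.exists_countable_dense unitInterval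
  have hall : ∀ᵐ ω ∂μ, ∀ t ∈ D, X t ω ∈ φ t '' K :=
    (ae_ball_iff hDc).2 fun t _ => hφ.ae_mem_image ha hm hc hvel hv hL hK hX₀ t
  filter_upwards [hall, hc] with ω hω hcω t
  have hcl := isClosed_setOf_mem_image (hφ.continuous_uncurry ha hL) hK hcω
  exact hcl.closure_subset_iff.2 (fun s hs => hω s hs) (hD t)

end

/-- A process which follows a Lipschitz flow on average stays in the image of the initial support
under that flow, so it cannot pass from one separated part of the support to another. The masses of
the two parts play no role in this. -/
theorem HasDisconnectedSupportOn.straightLineProcesses_eq_empty {Ω : Type*} [MeasurableSpace Ω]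
    (μ : Measure Ω) [IsProbabilityMeasure μ] {d : ℕ} {P : Measure (Euc d)}
    [IsProbabilityMeasure P] {S₀ S₁ : Set (Euc d)} (hP : HasDisconnectedSupportOn P S₀ S₁) :
    straightLineProcesses μ P P = ∅ := by
  refine Set.eq_empty_iff_forall_notMem.2 ?_
  rintro X ⟨hX, hvel, v, φ, hv, hL, hφ, ha⟩
  have hK₀ : IsCompact (closure S₀) := hP.isBounded₀.isCompact_closure
  have hK₁ : IsCompact (closure S₁) := hP.isBounded₁.isCompact_closure
  have hcl : ∀ S : Set (Euc d), closure S ⊆ closedConvexHull ℝ S := fun S =>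
    closure_minimal subset_closedConvexHull isClosed_closedConvexHull
  have hdisj : Disjoint (closure S₀) (closure S₁) :=
    (Set.disjoint_iff_inter_eq_empty.2 hP.disjoint_closedConvexHull).mono (hcl _) (hcl _)
  have hprod : Measurable fun ω => (X 0 ω, X 1 ω) := (hX.measurable 0).prodMk (hX.measurable 1)
  have hlaw : ∀ {A B : Set (Euc d)}, MeasurableSet A → MeasurableSet B →
      P A * P B = μ {ω | X 0 ω ∈ A ∧ X 1 ω ∈ B} := fun {A B} hA hB => by
    rw [← Measure.prod_prod, ← hX.law_endpoints, Measure.map_apply hprod (hA.prod hB)]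
    rfl
  have hX₀ : ∀ᵐ ω ∂μ, X 0 ω ∈ closure S₀ ∪ closure S₁ := by
    have h := hlaw (hK₀.union hK₁).measurableSet.compl MeasurableSet.univ
    rw [← hP.support_eq, Measure.measure_compl_support, zero_mul] at h
    rw [ae_iff, ← hP.support_eq]
    simpa using h.symm
  have hpath := hφ.ae_forall_mem_image ha hX.measurable hX.continuous_paths hvel hv hL
    (hK₀.union hK₁) hX₀
  have hφc := hφ.continuous_uncurry ha hL
  have hinj := hφ.injective ha
  have hB : ∀ {K : Set (Euc d)}, IsCompact K → MeasurableSet (φ 1 '' K) := fun hK =>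
    (hK.image (hφc.comp (Continuous.prodMk_right 1))).measurableSet
  have hφ0 : ∀ K : Set (Euc d), φ 0 '' K = K := fun K => by
    rw [show φ 0 = id from funext hφ.initial, Set.image_id]
  -- Starting in `K` and ending in `φ 1 '' K'` is almost surely impossible, but by independence has
  -- probability `P K * P (φ 1 '' K')`.
  have hnull : ∀ {K K' : Set (Euc d)}, IsCompact K → IsCompact K' → Disjoint K K' →
      closure S₀ ∪ closure S₁ = K ∪ K' → P K ≠ 0 → P (φ 1 '' K') = 0 :=
    fun {K K'} hK hK' hd hu hne => by
      refine (mul_eq_zero.1 ((hlaw hK.measurableSet (hB hK')).trans ?_)).resolve_left hne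
      rw [measure_eq_zero_iff_ae_notMem]
      filter_upwards [hpath, hX.continuous_paths] with ω hω hcω
      rintro ⟨h0, h1⟩
      have h := mem_image_of_forall_mem_image_union hφc hinj hK hK' hd hcω
        (fun t => hu ▸ hω t) (a := 0) (by rwa [hφ0]) 1
      exact Set.disjoint_left.1 (Set.disjoint_image_of_injective (hinj 1) hd) h h1
  have h₁ : P (φ 1 '' closure S₁) = 0 := hnull hK₀ hK₁ hdisj rfl
    (hP.pos₀.trans_le (measure_mono subset_closure)).ne'
  have h₀ : P (φ 1 '' closure S₀) = 0 := hnull hK₁ hK₀ hdisj.symm (Set.union_comm _ _)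
    (hP.pos₁.trans_le (measure_mono subset_closure)).ne'
  have hunion : P (φ 1 '' (closure S₀ ∪ closure S₁)) = 0 := by
    rw [Set.image_union]; exact measure_union_null h₀ h₁
  have hlast := hlaw MeasurableSet.univ (hB (hK₀.union hK₁))
  rw [hunion, mul_zero] at hlast
  -- `X 1` almost surely avoids the very set in which `hpath` places it.
  have hnot := measure_eq_zero_iff_ae_notMem.1 hlast.symm
  obtain ⟨ω, h1, h2⟩ := (hnot.and hpath).exists
  exact h1 ⟨trivial, h2 1⟩

set_option linter.unusedVariables false in
theorem mainTheorem3 {Ω : Type*} [MeasurableSpace Ω] (μ : Measure Ω) [IsProbabilityMeasure μ]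
    {d : ℕ} (P : Measure (Euc d)) [IsProbabilityMeasure P] (S₀ S₁ : Set (Euc d))
    (hP : HasDisconnectedSupportOn P S₀ S₁) (hne : P S₀ ≠ P S₁) :
    straightLineProcesses μ P P = ∅ :=
  hP.straightLineProcesses_eq_empty μ
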